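/- Let $\mathcal H$ be a finite-dimensional Hilbert space, $\Omega$ a finite set, and let $\{C_\omega\}_{\omega\in\Omega}$ be an instrument: each $C_\omega$ is a completely positive map on the matrices on $\mathcal H$, and $\Lambda:=\sum_\omega C_\omega$ is trace-preserving. Let $r(\cdot)$ denote the spectral radius, let $x_\omega\in\mathbb R$ for $\omega\in\Omega$, and put $\Lambda_\theta:=\sum_\omega e^{\theta x_\omega}C_\omega$ and $\phi(\theta):=\log\lambda_\theta$ for $\theta\in\mathbb R$, where $\lambda_\theta=r(\Lambda_\theta)$ is the Perron–Frobenius eigenvalue of $\Lambda_\theta$. Assume that $\Lambda$ is primitive: $r(\Lambda)>0$ and there are strictly positive definite matrices $\rho$, $A$ with $\operatorname{Tr}\rho A=1$ such that $\lim_{k\to\infty}(r(\Lambda)^{-1}\Lambda)^k(H)=(\operatorname{Tr}AH)\,\rho$ for every Hermitian matrix $H$. Then $\Lambda$ has exactly one Perron–Frobenius eigenvector $\rho_0$ of trace one (a strictly positive definite matrix with $\operatorname{Tr}\rho_0=1$ and $\Lambda(\rho_0)=r(\Lambda)\rho_0$). With $\tilde\Lambda(H):=(\operatorname{Tr}H)\rho_0$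 and $\iota$ the identity map, the quantum fundamental matrix $Z:=(\iota-(\Lambda-\tilde\Lambda))^{-1}$ exists and equals $\sum_{k=0}^\infty(\Lambda-\tilde\Lambda)^k$. With $C_X:=\sum_\omega x_\omega C_\omega$, the function $\phi$ is twice continuously differentiable at $0$, and $$\phi''(0)=\mathsf V_{\rho_0}[X]+2\operatorname{Tr}\,C_X\circ(Z-\tilde\Lambda)\circ C_X(\rho_0),$$ where $\mathsf V_{\rho_0}[X]$ is the variance of the random variable $X(\omega)=x_\omega$ when $\omega$ has probability $\operatorname{Tr}C_\omega(\rho_0)$. -/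

import Mathlib

open scoped Matrix.Norms.L2Operator MatrixOrder ComplexOrder CStarAlgebra
open scoped Topology ProbabilityTheory
open Filter MeasureTheory

namespace QuantumHMM

/-- The spectral radius `r(Λ)` of a linear map on matrices: the largest modulus of an eigenvalue. -/
noncomputable def specRad {n : Type*} [Fintype n] [DecidableEq n]
    (L : Module.End ℂ (Matrix n n ℂ)) : ℝ :=
  (spectralRadius ℂ L).toReal

/-- `Λ` is primitive: `r(Λ) > 0` and there are strictly positive definite matrices `ρ₀`, `A₀`
with `Tr ρ₀ A₀ = 1` such that `(r(Λ)⁻¹ Λ)ᵏ(H) → (Tr A₀ H) ρ₀` for every Hermitian matrix `H`. -/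
def IsPrimitive {n : Type*} [Fintype n] [DecidableEq n]
    (L : Module.End ℂ (Matrix n n ℂ)) : Prop :=
  0 < specRad L ∧ ∃ ρ₀ A₀ : Matrix n n ℂ, ρ₀.PosDef ∧ A₀.PosDef ∧ (ρ₀ * A₀).trace = 1 ∧
    ∀ H : Matrix n n ℂ, H.IsHermitian →
      Tendsto (fun k : ℕ => (((((specRad L)⁻¹ : ℝ) : ℂ) • L) ^ k) H) atTop
        (𝓝 ((A₀ * H).trace • ρ₀))

/-- `ρ` is a Perron-Frobenius eigenvector of `Λ` of trace one: a strictly positive definite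
eigenvector for the eigenvalue `r(Λ)`, with trace one. -/
structure IsPerronFrobeniusState {n : Type*} [Fintype n] [DecidableEq n]
    (L : Module.End ℂ (Matrix n n ℂ)) (ρ : Matrix n n ℂ) : Prop where
  posDef : ρ.PosDef
  trace_eq_one : ρ.trace = 1
  eigen : L ρ = ((specRad L : ℝ) : ℂ) • ρ

section Instrument

variable {n Ω : Type*} [Fintype n] [DecidableEq n] [Fintype Ω]

/-- The map `Λ = ∑ ω, C_ω`. -/
noncomputable def total (C : Ω → (Matrix n n ℂ →CP Matrix n n ℂ)) :
    Module.End ℂ (Matrix n n ℂ) :=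
  ∑ ω, (C ω).toLinearMap

/-- The map `Λ_θ = ∑ ω, exp (θ x_ω) C_ω`. -/
noncomputable def tilted (C : Ω → (Matrix n n ℂ →CP Matrix n n ℂ)) (x : Ω → ℝ) (θ : ℝ) :
    Module.End ℂ (Matrix n n ℂ) :=
  ∑ ω, ((Real.exp (θ * x ω) : ℝ) : ℂ) • (C ω).toLinearMap

/-- `φ(θ) = log λ_θ`, where `λ_θ = r(Λ_θ)` is the Perron-Frobenius eigenvalue of `Λ_θ`. -/
noncomputable def phi (C : Ω → (Matrix n n ℂ →CP Matrix n n ℂ)) (x : Ω → ℝ) (θ : ℝ) : ℝ :=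
  Real.log (specRad (tilted C x θ))

/-- The map `C_X = ∑ ω, x_ω C_ω`. -/
noncomputable def weighted (C : Ω → (Matrix n n ℂ →CP Matrix n n ℂ)) (x : Ω → ℝ) :
    Module.End ℂ (Matrix n n ℂ) :=
  ∑ ω, ((x ω : ℝ) : ℂ) • (C ω).toLinearMap

/-- The distribution of the outcome of one measurement in the state `ρ`: the outcome `ω` has
probability `Tr C_ω(ρ)`. -/
noncomputable def outcomeLaw [MeasurableSpace Ω] (C : Ω → (Matrix n n ℂ →CP Matrix n n ℂ))
    (ρ : Matrix n n ℂ) : Measure Ω :=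
  ∑ ω, ENNReal.ofReal (C ω ρ).trace.re • Measure.dirac ω

end Instrument

/-- The map `Λ̃ : H ↦ (Tr H) ρ₀`. -/
noncomputable def traceProj {n : Type*} [Fintype n] (ρ₀ : Matrix n n ℂ) :
    Module.End ℂ (Matrix n n ℂ) :=
  (Matrix.traceLinearMap n ℂ ℂ).smulRight ρ₀

/-- The quantum fundamental matrix `Z = (ι - (Λ - Λ̃))⁻¹`, the inverse being taken in the ring of
linear maps on matrices (by convention `0` when there is no inverse). -/
noncomputable def fundamental {n : Type*} [Fintype n]
    (L : Module.End ℂ (Matrix n n ℂ)) (ρ₀ : Matrix n n ℂ) : Module.End ℂ (Matrix n n ℂ) :=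
  Ring.inverse (1 - (L - traceProj ρ₀))

end QuantumHMM

namespace QuantumHMM

/-! Taking traces in the primitivity limit forces $r(\Lambda)=1$ and
$\Lambda^kM\to(\operatorname{Tr}M)\rho_0$ (`IsPrimitive.exists_tendsto`). Hence the powers of
$\Lambda-\tilde\Lambda$ tend to $0$; in finite dimension its spectral radius is below one and the
Neumann series gives $Z$. Likewise every eigenvalue of $\Lambda$ other than $1$ has modulus below
one.

Invertibility of $\iota-(\Lambda-\tilde\Lambda)$ lets the implicit function theorem produce a $C^2$
eigenvalue branch $l(\theta)$ through $1$ (`exists_eigenvalue_branch`). The spectral gap makes $|l|$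
the spectral radius of $\Lambda_\theta$ for small $\theta$ (`spectralRadius_eventually_eq_branch`),
so no Perron–Frobenius theory is needed for $\theta\ne0$.

Differentiating $\Lambda_\theta v=l\,v$ with $\operatorname{Tr}v=1$ gives
$l'(0)=\operatorname{Tr}C_X\rho_0$, $v'(0)=(Z-\tilde\Lambda)C_X\rho_0$ and
$l''(0)=\operatorname{Tr}C_{X^2}\rho_0+2\operatorname{Tr}C_Xv'(0)$, where $C_{X^2}=\sum_\omega
x_\omega^2C_\omega$ (`hasDerivAt_eigenvalue_branch`). The logarithm subtracts $l'(0)^2$, which turns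
the first term into the variance. -/

lemma hasDerivAt_deriv {F : Type*} [NormedAddCommGroup F] [NormedSpace ℝ F] {f : ℝ → F} {t : ℝ}
    (hf : ContDiffAt ℝ 2 f t) : HasDerivAt (deriv f) (deriv (deriv f) t) t := by
  have : ContDiffAt ℝ 1 (deriv f) t :=
    (hf.fderiv_right (m := 1) (by norm_num)).clm_apply contDiffAt_const
  exact (this.differentiableAt (by norm_num)).hasDerivAt

/-! ### Perturbation of a simple isolated eigenvalue. -/

section Perturbation

variable {E : Type*} [NormedAddCommGroup E] [NormedSpace ℂ E]

/-- Evaluation of complex-linear operators, as a real bilinear map. -/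
noncomputable def evalBilin (E : Type*) [NormedAddCommGroup E] [NormedSpace ℂ E] :
    (E →L[ℂ] E) →L[ℝ] E →L[ℝ] E :=
  (ContinuousLinearMap.id ℂ (E →L[ℂ] E)).bilinearRestrictScalars ℝ

@[simp] lemma evalBilin_apply (T : E →L[ℂ] E) (v : E) : evalBilin E T v = T v := rfl

lemma contDiffAt_operator_apply {F : Type*} [NormedAddCommGroup F] [NormedSpace ℝ F]
    {k : WithTop ℕ∞} {T : F → E →L[ℂ] E} {v : F → E} {p : F}
    (hT : ContDiffAt ℝ k T p) (hv : ContDiffAt ℝ k v p) :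
    ContDiffAt ℝ k (fun q => T q (v q)) p :=
  ((evalBilin E).contDiff.contDiffAt.comp p hT).clm_apply hv

lemma hasDerivAt_operator_apply {T : ℝ → E →L[ℂ] E} {v : ℝ → E} {T' : E →L[ℂ] E} {v' : E} {t : ℝ}
    (hT : HasDerivAt T T' t) (hv : HasDerivAt v v' t) :
    HasDerivAt (fun s => T s (v s)) (T t v' + T' (v t)) t := by
  simpa using (evalBilin E).hasDerivAt_of_bilinear (fun _ => hT) (fun _ => hv)

lemma hasDerivAt_functional_apply {τ : E →L[ℂ] ℂ} {v : ℝ → E} {v' : E} {t : ℝ}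
    (hv : HasDerivAt v v' t) : HasDerivAt (fun s => τ (v s)) (τ v') t :=
  (τ.restrictScalars ℝ).hasFDerivAt.comp_hasDerivAt t hv

/-- A `C²` branch of a simple eigenvalue, with uniqueness near the base point. -/
lemma exists_eigenvalue_branch [CompleteSpace E] {L : ℝ → E →L[ℂ] E} (hL : ContDiffAt ℝ 2 L 0)
    {ρ : E} {τ : E →L[ℂ] ℂ} (hτρ : τ ρ = 1) (hLρ : L 0 ρ = ρ)
    (hU : IsUnit (1 - (L 0 - τ.smulRight ρ))) :
    ∃ l : ℝ → ℂ, ∃ v : ℝ → E, ContDiffAt ℝ 2 l 0 ∧ ContDiffAt ℝ 2 v 0 ∧ l 0 = 1 ∧ v 0 = ρ ∧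
      (∀ᶠ t in 𝓝 0, L t (v t) = l t • v t) ∧ (∀ᶠ t in 𝓝 0, τ (v t) = 1) ∧
      ∀ᶠ p in 𝓝 ((0 : ℝ), (1 : ℂ)), ∀ w, w ≠ 0 → L p.1 w = p.2 • w → p.2 = l p.1 := by
  -- The rank-one term makes $R(t,\mu)=\mu-L_t+\tau(\cdot)\rho$ invertible near $(0,1)$. There
  -- $L_tw=\mu w$ means $Rw=\tau(w)\rho$, so $\mu$ is an eigenvalue exactly when
  -- $g(t,\mu)=\tau(R^{-1}\rho)=1$, with eigenvector $R^{-1}\rho$.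
  set R : ℝ × ℂ → E →L[ℂ] E := fun p => p.2 • 1 - (L p.1 - τ.smulRight ρ) with hR
  have hR0 : R (0, 1) = 1 - (L 0 - τ.smulRight ρ) := by simp [hR]
  have hRU : IsUnit (R (0, 1)) := by rwa [hR0]
  have hRc : ContDiffAt ℝ 2 R (0, 1) := by
    have h1 : ContDiffAt ℝ 2 (fun p : ℝ × ℂ => L p.1) (0, 1) :=
      ContDiffAt.comp (0, 1) (f := Prod.fst) hL contDiffAt_fst
    have h2 : ContDiffAt ℝ 2 (fun p : ℝ × ℂ => p.2 • (1 : E →L[ℂ] E)) (0, 1) :=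
      contDiffAt_snd.smul contDiffAt_const
    exact h2.sub (h1.sub contDiffAt_const)
  have hRinv : ContDiffAt ℝ 2 (fun p => Ring.inverse (R p)) (0, 1) := by
    obtain ⟨u, hu⟩ := hRU
    exact ContDiffAt.comp (0, 1) (g := Ring.inverse) (hu ▸ contDiffAt_ringInverse ℝ u) hRc
  have hRunit : ∀ᶠ p in 𝓝 ((0 : ℝ), (1 : ℂ)), IsUnit (R p) :=
    hRc.continuousAt.eventually (Units.isOpen.mem_nhds hRU)
  have hDρ : ∀ μ : ℂ, R (0, μ) ρ = μ • ρ := fun μ => by simp [hR, hLρ, hτρ]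
  have hinv : ∀ {p x y}, IsUnit (R p) → R p x = y → Ring.inverse (R p) y = x := by
    intro p x y hp hxy
    rw [← hxy, ← mul_apply_eq_comp, Ring.inverse_mul_cancel _ hp,
      one_apply_eq_self]
  set W : ℝ × ℂ → E := fun p => Ring.inverse (R p) ρ with hW
  have hWc : ContDiffAt ℝ 2 W (0, 1) := contDiffAt_operator_apply hRinv contDiffAt_const
  set g : ℝ × ℂ → ℂ := fun p => τ (W p) with hg
  have hgc : ContDiffAt ℝ 2 g (0, 1) :=
    (τ.restrictScalars ℝ).contDiff.contDiffAt.comp (0, 1) hWc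
  have hW1 : W (0, 1) = ρ := hinv hRU (by simpa using hDρ 1)
  have hg1 : g (0, 1) = 1 := by simp [hg, hW1, hτρ]
  -- At $t=0$ the function is explicitly $1/\mu$, so its $\mu$-derivative at $1$ is $-1$, the
  -- nondegeneracy that the implicit function theorem needs.
  have hgμ : (fun μ : ℂ => g (0, μ)) =ᶠ[𝓝 1] fun μ => μ⁻¹ := by
    have h0 : Tendsto (fun μ : ℂ => ((0 : ℝ), μ)) (𝓝 1) (𝓝 (0, 1)) :=
      (Continuous.prodMk_right (0 : ℝ)).tendsto 1
    filter_upwards [h0.eventually hRunit, eventually_ne_nhds (one_ne_zero (α := ℂ))] with μ hμ hne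
    have : W (0, μ) = μ⁻¹ • ρ := hinv hμ (by rw [map_smul, hDρ, inv_smul_smul₀ hne])
    simp [hg, this, hτρ]
  have hderiv : fderiv ℝ g (0, 1) ∘L .inr ℝ ℝ ℂ
      = ((ContinuousLinearEquiv.neg ℝ : ℂ ≃L[ℝ] ℂ) : ℂ →L[ℝ] ℂ) := by
    have h1 : HasFDerivAt (fun μ : ℂ => g (0, μ)) (fderiv ℝ g (0, 1) ∘L .inr ℝ ℝ ℂ) 1 :=
      (hgc.differentiableAt (by norm_num)).hasFDerivAt.comp 1
        (hasFDerivAt_prodMk_right (0 : ℝ) (1 : ℂ))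
    have h2 : HasFDerivAt (fun μ : ℂ => g (0, μ)) _ 1 :=
      ((hasFDerivAt_inv (𝕜 := ℂ) one_ne_zero).restrictScalars ℝ).congr_of_eventuallyEq hgμ
    rw [h1.unique h2]
    ext; simp
  have hinvble : (fderiv ℝ g (0, 1) ∘L .inr ℝ ℝ ℂ).IsInvertible := ⟨_, hderiv.symm⟩
  have h2 : (2 : WithTop ℕ∞) ≠ 0 := by norm_num
  set l := hgc.implicitFunction h2 hinvble with hl
  have hlc : ContDiffAt ℝ 2 l 0 := hgc.contDiffAt_implicitFunction h2 hinvble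
  have hl0 : l 0 = 1 := hgc.implicitFunction_apply_self h2 hinvble
  have hpair : ContDiffAt ℝ 2 (fun t : ℝ => (t, l t)) 0 := contDiffAt_id.prodMk hlc
  have hpair0 : Tendsto (fun t : ℝ => (t, l t)) (𝓝 0) (𝓝 (0, 1)) := by
    simpa [hl0] using hpair.continuousAt.tendsto
  have hτv : ∀ᶠ t in 𝓝 0, τ (W (t, l t)) = 1 := by
    filter_upwards [hgc.eventually_apply_implicitFunction h2 hinvble] with t ht
    simpa only [hg1] using ht
  refine ⟨l, fun t => W (t, l t), hlc, ?_, hl0, by simp [hl0, hW1], ?_, hτv, ?_⟩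
  · exact ContDiffAt.comp 0 (g := W) (by simpa [hl0] using hWc) hpair
  · filter_upwards [hτv, hpair0.eventually hRunit] with t ht hu
    have : R (t, l t) (W (t, l t)) = ρ := by
      simp only [hW]
      rw [← mul_apply_eq_comp, Ring.mul_inverse_cancel _ hu,
        one_apply_eq_self]
    generalize W (t, l t) = w at *
    simp only [hR, sub_apply, smul_apply,
      one_apply_eq_self, ContinuousLinearMap.smulRight_apply, ht, one_smul] at this
    rw [← sub_eq_zero, ← neg_eq_zero]
    rw [← sub_eq_zero] at this
    rw [← this]; abel
  · filter_upwards [hRunit, hgc.eventually_apply_eq_iff_implicitFunction h2 hinvble]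
      with p hu hiff w hw hLw
    refine (hiff.1 ?_).symm
    rw [hg1]
    have h3 : R p w = τ w • ρ := by
      simp [hR, hLw]
    have h4 := hinv hu h3
    rw [map_smul] at h4
    have h5 : τ w ≠ 0 := by
      rintro h
      exact hw (by rw [← h4, h, zero_smul])
    have h6 : τ w * g p = τ w := by
      conv_rhs => rw [← h4]
      simp [hg, hW]
    exact mul_left_cancel₀ h5 (by rw [h6, mul_one])

/-- First and second order perturbation of a simple eigenvalue. -/
lemma hasDerivAt_eigenvalue_branch {L L₁ : ℝ → E →L[ℂ] E} {L₂ : E →L[ℂ] E}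
    (hL : ∀ t, HasDerivAt L (L₁ t) t) (hL₁ : HasDerivAt L₁ L₂ 0)
    {ρ : E} {τ : E →L[ℂ] ℂ} (hτL : ∀ w, τ (L 0 w) = τ w) (hLρ : L 0 ρ = ρ)
    {l : ℝ → ℂ} {v : ℝ → E} (hv : ContDiffAt ℝ 2 v 0) (hl0 : l 0 = 1)
    (hv0 : v 0 = ρ) (hLv : ∀ᶠ t in 𝓝 0, L t (v t) = l t • v t) (hτv : ∀ᶠ t in 𝓝 0, τ (v t) = 1)
    {Z : E →L[ℂ] E} (hZ : Z * (1 - (L 0 - τ.smulRight ρ)) = 1) :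
    deriv l 0 = τ (L₁ 0 ρ) ∧
      HasDerivAt (deriv l) (τ (L₂ ρ) + 2 * τ (L₁ 0 ((Z - τ.smulRight ρ) (L₁ 0 ρ)))) 0 := by
  have hτρ : τ ρ = 1 := hv0 ▸ hτv.self_of_nhds
  have hvd : ∀ᶠ t in 𝓝 0, HasDerivAt v (deriv v t) t := by
    filter_upwards [hv.eventually (by norm_num)] with t ht
    exact (ht.differentiableAt (by norm_num)).hasDerivAt
  have hv2 := hasDerivAt_deriv hv
  have hleq : l =ᶠ[𝓝 0] fun t => τ (L t (v t)) := by
    filter_upwards [hLv, hτv] with t h1 h2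
    rw [h1, map_smul, h2, smul_eq_mul, mul_one]
  have hd : ∀ᶠ t in 𝓝 0, HasDerivAt l (τ (L t (deriv v t)) + τ (L₁ t (v t))) t := by
    filter_upwards [hvd, hleq.eventuallyEq_nhds] with t h1 h2
    rw [← map_add]
    exact (hasDerivAt_functional_apply
      (hasDerivAt_operator_apply (hL t) h1)).congr_of_eventuallyEq h2
  have hτv' : ∀ᶠ t in 𝓝 0, τ (deriv v t) = 0 := by
    filter_upwards [hvd, hτv.eventually_nhds] with t h1 h2
    have h3 := hasDerivAt_functional_apply (τ := τ) h1
    have h4 : HasDerivAt (fun s => τ (v s)) 0 t :=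
      (hasDerivAt_const t (1 : ℂ)).congr_of_eventuallyEq h2
    exact h3.unique h4
  have hτv'' : τ (deriv (deriv v) 0) = 0 :=
    (hasDerivAt_functional_apply (τ := τ) hv2).unique
      ((hasDerivAt_const 0 (0 : ℂ)).congr_of_eventuallyEq hτv')
  have hl1 : HasDerivAt l (τ (L₁ 0 ρ)) 0 := by
    simpa [hτL, hτv'.self_of_nhds, hv0] using hd.self_of_nhds
  refine ⟨hl1.deriv, ?_⟩
  -- The differentiated equation is $(1-L_0)v'=L_1\rho-l'\rho$. Since $\tau(v')=0$, the singular
  -- $1-L_0$ may be replaced by the operator that $Z$ inverts, and $Z\rho=\rho$.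
  have hv' : deriv v 0 = (Z - τ.smulRight ρ) (L₁ 0 ρ) := by
    have h1 := hasDerivAt_operator_apply (hL 0) hvd.self_of_nhds
    have h2 := (hl1.smul hvd.self_of_nhds).congr_of_eventuallyEq hLv
    have h3 := h1.unique h2
    rw [hv0, hl0, one_smul] at h3
    have h4 : (1 - (L 0 - τ.smulRight ρ)) (deriv v 0) = L₁ 0 ρ - τ (L₁ 0 ρ) • ρ := by
      simp only [sub_apply, one_apply_eq_self,
        ContinuousLinearMap.smulRight_apply, hτv'.self_of_nhds, zero_smul, sub_zero]
      linear_combination (norm := module) -h3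
    have h5 : ∀ w, Z ((1 - (L 0 - τ.smulRight ρ)) w) = w := fun w => by
      rw [← mul_apply_eq_comp, hZ, one_apply_eq_self]
    have h6 : Z ρ = ρ := by
      have := h5 ρ
      simpa [hLρ, hτρ] using this
    rw [← h5 (deriv v 0), h4]
    simp [h6]
  have hdl : deriv l =ᶠ[𝓝 0] fun t => τ (L t (deriv v t) + L₁ t (v t)) := by
    filter_upwards [hd] with t ht
    rw [ht.deriv, map_add]
  have := (hasDerivAt_functional_apply (τ := τ)
    ((hasDerivAt_operator_apply (hL 0) hv2).add
      (hasDerivAt_operator_apply hL₁ hvd.self_of_nhds))).congr_of_eventuallyEq hdl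
  refine this.congr_deriv ?_
  -- The unknown $v''$ drops out because $\tau(L_0v'')=\tau(v'')=0$; the two copies of $\tau(L_1v')$
  -- give the factor $2$.
  simp only [map_add, hτL, hτv'', hv', hv0]
  ring

/-- The spectrum at the base point is finite, so its part away from $1$ lies in a disc of radius
$s<1$; upper hemicontinuity of the spectrum transfers this to nearby operators. -/
lemma spectrum_eventually_norm_lt_or_near_one [CompleteSpace E] [FiniteDimensional ℂ E]
    {X : Type*} [TopologicalSpace X] {L : X → E →L[ℂ] E} {x₀ : X} (hL : ContinuousAt L x₀)
    (h0 : ∀ μ ∈ spectrum ℂ (L x₀), μ ≠ 1 → ‖μ‖ < 1) :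
    ∃ s < 1, ∀ ε > 0, ∀ᶠ t in 𝓝 x₀, ∀ μ ∈ spectrum ℂ (L t), ‖μ‖ < s ∨ dist μ 1 < ε := by
  have hfin : (spectrum ℂ (L x₀)).Finite := by
    have := Module.End.finite_spectrum ((Module.End.toContinuousLinearMap E).symm (L x₀))
    rwa [AlgEquiv.spectrum_eq] at this
  obtain ⟨s, hs1, hs⟩ : ∃ s < (1 : ℝ), ∀ μ ∈ spectrum ℂ (L x₀) \ {1}, ‖μ‖ < s := by
    have hev : ∀ᶠ s in 𝓝[<] (1 : ℝ), ∀ μ ∈ spectrum ℂ (L x₀) \ {1}, ‖μ‖ < s :=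
      (hfin.subset Set.sdiff_subset).eventually_all.2 fun μ hμ =>
        mem_of_superset (Ioo_mem_nhdsLT (h0 μ hμ.1 hμ.2)) fun s hs => hs.1
    obtain ⟨s, h1, h2⟩ := (hev.and self_mem_nhdsWithin).exists
    exact ⟨s, h2, h1⟩
  refine ⟨s, hs1, fun ε hε => ?_⟩
  have hopen : IsOpen {μ : ℂ | ‖μ‖ < s ∨ dist μ 1 < ε} :=
    (isOpen_lt continuous_norm continuous_const).union Metric.isOpen_ball
  have hus := upperHemicontinuousAt_iff_forall_isOpen.1
    ((upperHemicontinuous_spectrum ℂ (E →L[ℂ] E)).upperHemicontinuousAt (L x₀)) _ hopen (by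
      intro μ hμ
      by_cases h : μ = 1
      · right; simpa [h] using hε
      · left; exact hs μ ⟨hμ, h⟩)
  filter_upwards [hL.eventually hus] with t ht μ hμ using ht hμ

lemma mem_spectrum_iff_exists_eigenvector [FiniteDimensional ℂ E] (T : E →L[ℂ] E) (μ : ℂ) :
    μ ∈ spectrum ℂ T ↔ ∃ w, w ≠ 0 ∧ T w = μ • w := by
  have h : spectrum ℂ T = spectrum ℂ ((Module.End.toContinuousLinearMap E).symm T) :=
    (AlgEquiv.spectrum_eq _ _).symm
  rw [h, ← Module.End.hasEigenvalue_iff_mem_spectrum]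
  constructor
  · intro hμ
    obtain ⟨w, hw⟩ := hμ.exists_hasEigenvector
    exact ⟨w, hw.2, hw.apply_eq_smul⟩
  · rintro ⟨w, hw, hTw⟩
    exact Module.End.hasEigenvalue_of_hasEigenvector ⟨Module.End.mem_eigenspace_iff.2 hTw, hw⟩

/-- The spectral radius follows the eigenvalue branch. -/
lemma spectralRadius_eventually_eq_branch [CompleteSpace E] [FiniteDimensional ℂ E]
    {L : ℝ → E →L[ℂ] E} (hL : ContinuousAt L 0)
    (h0 : ∀ μ ∈ spectrum ℂ (L 0), μ ≠ 1 → ‖μ‖ < 1)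
    {l : ℝ → ℂ} (hl : ContinuousAt l 0) (hl0 : l 0 = 1)
    (hmem : ∀ᶠ t in 𝓝 0, l t ∈ spectrum ℂ (L t))
    (huniq : ∀ᶠ p in 𝓝 ((0 : ℝ), (1 : ℂ)), p.2 ∈ spectrum ℂ (L p.1) → p.2 = l p.1) :
    ∀ᶠ t in 𝓝 0, (spectralRadius ℂ (L t)).toReal = ‖l t‖ := by
  obtain ⟨s, hs1, hs⟩ := spectrum_eventually_norm_lt_or_near_one hL h0
  rw [nhds_prod_eq] at huniq
  obtain ⟨pa, ha, pb, hb, hab⟩ := eventually_prod_iff.1 huniq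
  obtain ⟨ε, hε, hball⟩ := Metric.eventually_nhds_iff.1 hb
  have hls : ∀ᶠ t in 𝓝 0, s < ‖l t‖ :=
    hl.norm.eventually_const_lt (by simpa [hl0] using hs1)
  filter_upwards [hs ε hε, ha, hmem, hls] with t h1 h2 h3 h4
  have : spectralRadius ℂ (L t) = ‖l t‖₊ := by
    refine le_antisymm (iSup₂_le fun μ hμ => ?_) (le_iSup₂_of_le (l t) h3 le_rfl)
    rcases h1 μ hμ with h | h
    · exact_mod_cast (h.trans h4).le
    · exact (congrArg (fun z : ℂ => (‖z‖₊ : ENNReal)) (hab h2 (hball h) hμ)).le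
  rw [this]; rfl

end Perturbation

/-- The second derivative of the logarithm of the modulus of a real-valued branch. -/
lemma iteratedDeriv_two_log_norm {l : ℝ → ℂ} (hl : ContDiffAt ℝ 2 l 0) (hl0 : l 0 = 1)
    (hreal : ∀ᶠ t in 𝓝 0, star (l t) = l t) {f : ℝ → ℝ}
    (hf : ∀ᶠ t in 𝓝 0, f t = Real.log ‖l t‖) :
    ContDiffAt ℝ 2 f 0 ∧
      ((iteratedDeriv 2 f 0 : ℝ) : ℂ) = deriv (deriv l) 0 - deriv l 0 ^ 2 := by
  set r : ℝ → ℝ := fun t => (l t).re with hr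
  have hrc : ContDiffAt ℝ 2 r 0 := Complex.reCLM.contDiff.contDiffAt.comp 0 hl
  have hr0 : r 0 = 1 := by simp [hr, hl0]
  have hlr : l =ᶠ[𝓝 0] fun t => (r t : ℂ) := by
    filter_upwards [hreal] with t ht
    exact (Complex.conj_eq_iff_re.1 ht).symm
  have hfr : f =ᶠ[𝓝 0] fun t => Real.log (r t) := by
    filter_upwards [hf, hlr] with t h1 h2
    rw [h1, h2, Complex.norm_real, Real.norm_eq_abs, Real.log_abs]
  have hfc : ContDiffAt ℝ 2 f 0 := (hrc.log (by simp [hr0])).congr_of_eventuallyEq hfr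
  refine ⟨hfc, ?_⟩
  have hrd : ∀ᶠ t in 𝓝 0, HasDerivAt r (deriv r t) t := by
    filter_upwards [hrc.eventually (by norm_num)] with t ht
    exact (ht.differentiableAt (by norm_num)).hasDerivAt
  have hr2 := hasDerivAt_deriv hrc
  have hl1 : deriv l =ᶠ[𝓝 0] fun t => ((deriv r t : ℝ) : ℂ) := by
    filter_upwards [hrd, hlr.eventuallyEq_nhds] with t h1 h2
    exact (h1.ofReal_comp.congr_of_eventuallyEq h2).deriv
  have hl2 : deriv (deriv l) 0 = (deriv (deriv r) 0 : ℝ) :=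
    (hr2.ofReal_comp.congr_of_eventuallyEq hl1).deriv
  have hf1 : deriv f =ᶠ[𝓝 0] fun t => deriv r t / r t := by
    filter_upwards [hrd, hfr.eventuallyEq_nhds,
      hrc.continuousAt.eventually_ne (by simp [hr0] : r 0 ≠ 0)] with t h1 h2 h3
    exact ((h1.log h3).congr_of_eventuallyEq h2).deriv
  have hf2 : deriv (deriv f) 0 = deriv (deriv r) 0 - deriv r 0 ^ 2 := by
    rw [((hr2.div hrd.self_of_nhds (by simp [hr0])).congr_of_eventuallyEq hf1).deriv, hr0]
    ring
  rw [iteratedDeriv_succ, iteratedDeriv_one, hf2, hl2, hl1.self_of_nhds]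
  push_cast
  rfl

/-! ### Exponentially tilted families of operators. -/

section ExponentialFamily

variable {E Ω : Type*} [NormedAddCommGroup E] [NormedSpace ℂ E] [Fintype Ω]

/-- The exponentially tilted sum of a finite family of operators. -/
noncomputable def expFamily (K : Ω → E →L[ℂ] E) (x : Ω → ℝ) (t : ℝ) : E →L[ℂ] E :=
  ∑ ω, ((Real.exp (t * x ω) : ℝ) : ℂ) • K ω

lemma hasDerivAt_expFamily_term (T : E →L[ℂ] E) (a t : ℝ) :
    HasDerivAt (fun s : ℝ => ((Real.exp (s * a) : ℝ) : ℂ) • T)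
      (((Real.exp (t * a) : ℝ) : ℂ) • ((a : ℂ) • T)) t := by
  have h1 : HasDerivAt (fun s : ℝ => Real.exp (s * a)) (Real.exp (t * a) * a) t := by
    simpa using ((hasDerivAt_id t).mul_const a).exp
  refine (h1.ofReal_comp.smul_const T).congr_deriv ?_
  rw [smul_smul]
  push_cast
  rfl

lemma hasDerivAt_expFamily (K : Ω → E →L[ℂ] E) (x : Ω → ℝ) (t : ℝ) :
    HasDerivAt (expFamily K x) (expFamily (fun ω => (x ω : ℂ) • K ω) x t) t := by
  have := HasDerivAt.fun_sum (u := Finset.univ)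
    fun ω _ => hasDerivAt_expFamily_term (K ω) (x ω) t
  exact this

lemma expFamily_zero (K : Ω → E →L[ℂ] E) (x : Ω → ℝ) : expFamily K x 0 = ∑ ω, K ω := by
  simp [expFamily]

lemma contDiff_expFamily (K : Ω → E →L[ℂ] E) (x : Ω → ℝ) {k : WithTop ℕ∞} :
    ContDiff ℝ k (expFamily K x) := by
  refine ContDiff.sum fun ω _ => ContDiff.fun_smul ?_ contDiff_const
  exact Complex.ofRealCLM.contDiff.comp (Real.contDiff_exp.comp (contDiff_id.mul contDiff_const))

/-- Second order perturbation theory for the logarithm of the spectral radius of an exponential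
family. -/
theorem iteratedDeriv_two_log_spectralRadius_expFamily [FiniteDimensional ℂ E]
    [StarAddMonoid E] [StarModule ℂ E] (K : Ω → E →L[ℂ] E) (x : Ω → ℝ)
    (hK : ∀ ω w, K ω (star w) = star (K ω w)) {ρ : E} {τ : E →L[ℂ] ℂ} (hτρ : τ ρ = 1)
    (hρ : (∑ ω, K ω) ρ = ρ) (hτ : ∀ w, τ ((∑ ω, K ω) w) = τ w)
    (h0 : ∀ μ ∈ spectrum ℂ (∑ ω, K ω), μ ≠ 1 → ‖μ‖ < 1) {Z : E →L[ℂ] E}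
    (hU : IsUnit (1 - (∑ ω, K ω - τ.smulRight ρ)))
    (hZ : Z * (1 - (∑ ω, K ω - τ.smulRight ρ)) = 1) {f : ℝ → ℝ}
    (hf : ∀ t, f t = Real.log (spectralRadius ℂ (expFamily K x t)).toReal) :
    ContDiffAt ℝ 2 f 0 ∧ ((iteratedDeriv 2 f 0 : ℝ) : ℂ) =
      τ ((∑ ω, ((x ω : ℂ) ^ 2) • K ω) ρ) - τ ((∑ ω, (x ω : ℂ) • K ω) ρ) ^ 2 +
      2 * τ ((∑ ω, (x ω : ℂ) • K ω) ((Z - τ.smulRight ρ) ((∑ ω, (x ω : ℂ) • K ω) ρ))) := by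
  have : CompleteSpace E := FiniteDimensional.complete ℂ E
  set L := expFamily K x with hLdef
  have hL0 : L 0 = ∑ ω, K ω := expFamily_zero K x
  rw [← hL0] at hρ hτ h0 hU hZ
  have hLc : ContDiffAt ℝ 2 L 0 := (contDiff_expFamily K x).contDiffAt
  have hLstar : ∀ t w, L t (star w) = star (L t w) := fun t w => by
    simp only [hLdef, expFamily, sum_apply, smul_apply, hK, star_sum, star_smul, Complex.star_def,
      Complex.conj_ofReal]
  obtain ⟨l, v, hl, hv, hl0, hv0, hLv, hτv, huniq⟩ :=
    exists_eigenvalue_branch hLc hτρ hρ hU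
  have hvne : ∀ᶠ t in 𝓝 0, v t ≠ 0 := by
    filter_upwards [hτv] with t ht h
    simp [h] at ht
  have hspec := spectralRadius_eventually_eq_branch hLc.continuousAt h0 hl.continuousAt hl0
    (by
      filter_upwards [hLv, hvne] with t h1 h2
      exact (mem_spectrum_iff_exists_eigenvector _ _).2 ⟨_, h2, h1⟩)
    (by
      filter_upwards [huniq] with p hp hmem
      obtain ⟨w, hw, h⟩ := (mem_spectrum_iff_exists_eigenvector _ _).1 hmem
      exact hp w hw h)
  -- Each $L_t$ commutes with the star, so $\overline{l(t)}$ is also an eigenvalue near $1$;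
  -- uniqueness of the branch makes it equal to $l(t)$.
  have hreal : ∀ᶠ t in 𝓝 0, star (l t) = l t := by
    have hc : ContinuousAt (fun t => (t, star (l t))) 0 :=
      continuousAt_id.prodMk (hl.continuousAt.star)
    have hc' : Tendsto (fun t => (t, star (l t))) (𝓝 0) (𝓝 (0, 1)) := by
      simpa [hl0] using hc.tendsto
    filter_upwards [hc'.eventually huniq, hLv, hvne] with t h1 h2 h3
    exact h1 (star (v t)) (star_ne_zero.2 h3) (by rw [hLstar, h2, star_smul])
  obtain ⟨hfc, hf2⟩ := iteratedDeriv_two_log_norm hl hl0 hreal (f := f) (by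
    filter_upwards [hspec] with t ht
    rw [hf, ht])
  refine ⟨hfc, ?_⟩
  have hL₁ : ∀ t, HasDerivAt L (expFamily (fun ω => (x ω : ℂ) • K ω) x t) t :=
    hasDerivAt_expFamily K x
  have hL₂ := hasDerivAt_expFamily (fun ω => (x ω : ℂ) • K ω) x 0
  obtain ⟨hd1, hd2⟩ := hasDerivAt_eigenvalue_branch hL₁ hL₂ hτ hρ hv hl0 hv0 hLv hτv hZ
  rw [hf2, hd1, hd2.deriv, expFamily_zero, expFamily_zero]
  simp only [smul_smul, ← sq]
  ring

end ExponentialFamily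

/-! ### Neumann series and decay of powers. -/

lemma summable_pow_of_spectralRadius_lt_one {A : Type*} [NormedRing A] [NormedAlgebra ℂ A]
    [CompleteSpace A] {a : A} (ha : spectralRadius ℂ a < 1) : Summable fun k : ℕ => a ^ k := by
  obtain ⟨r, har, hr1⟩ := ENNReal.lt_iff_exists_nnreal_btwn.1 ha
  have hr1' : r < 1 := by exact_mod_cast hr1
  refine Summable.of_norm_bounded_eventually_nat (g := fun k => (r : ℝ) ^ k)
    (summable_geometric_of_lt_one r.2 (by exact_mod_cast hr1')) ?_
  -- Gelfand's formula gives $\|a^k\|\le r^k$ eventually, for $r$ strictly between the spectral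
  -- radius and $1$.
  have hlim := spectrum.pow_nnnorm_pow_one_div_tendsto_nhds_spectralRadius a
  filter_upwards [hlim.eventually_lt_const har, eventually_gt_atTop 0] with k hk hk0
  rw [one_div] at hk
  have h := (ENNReal.rpow_inv_le_iff (by exact_mod_cast hk0)).1 hk.le
  rw [ENNReal.rpow_natCast] at h
  exact_mod_cast h

lemma norm_lt_one_of_tendsto_pow {E : Type*} [NormedAddCommGroup E] [NormedSpace ℂ E]
    {T : Module.End ℂ E} {μ : ℂ} {w : E} (hw : w ≠ 0) (hTw : T w = μ • w)
    (hlim : Tendsto (fun k : ℕ => (T ^ k) w) atTop (𝓝 0)) : ‖μ‖ < 1 := by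
  have hpow : ∀ k : ℕ, (T ^ k) w = μ ^ k • w := by
    intro k
    induction k with
    | zero => simp
    | succ k ih => rw [pow_succ', Module.End.mul_apply, ih, map_smul, hTw, smul_smul, pow_succ]
  have h1 : Tendsto (fun k : ℕ => ‖μ‖ ^ k * ‖w‖) atTop (𝓝 0) := by
    simpa [hpow, norm_smul] using hlim.norm
  have h2 := h1.mul_const ‖w‖⁻¹
  simp only [mul_assoc, mul_inv_cancel₀ (norm_ne_zero_iff.2 hw), mul_one, zero_mul] at h2
  simpa using tendsto_pow_atTop_nhds_zero_iff.1 h2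

/-- In finite dimension the spectrum consists of eigenvalues, so pointwise decay, tested on
eigenvectors, already bounds the spectral radius below one. -/
lemma summable_pow_of_tendsto_pow_apply {E : Type*} [NormedAddCommGroup E] [NormedSpace ℂ E]
    [FiniteDimensional ℂ E] [Nontrivial E] {T : Module.End ℂ E}
    (hlim : ∀ w, Tendsto (fun k : ℕ => (T ^ k) w) atTop (𝓝 0)) :
    Summable fun k : ℕ => (Module.End.toContinuousLinearMap E T) ^ k := by
  have : CompleteSpace E := FiniteDimensional.complete ℂ E
  refine summable_pow_of_spectralRadius_lt_one ?_
  rw [← ENNReal.coe_one]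
  refine spectrum.spectralRadius_lt_of_forall_lt _ fun μ hμ => ?_
  obtain ⟨w, hw, hTw⟩ := (mem_spectrum_iff_exists_eigenvector _ _).1 hμ
  exact_mod_cast norm_lt_one_of_tendsto_pow hw hTw (hlim w)

lemma isUnit_one_sub_of_summable {A : Type*} [Ring A] [TopologicalSpace A] [IsTopologicalRing A]
    [T2Space A] {a : A} (ha : Summable fun k : ℕ => a ^ k) :
    IsUnit (1 - a) ∧ Ring.inverse (1 - a) = ∑' k : ℕ, a ^ k := by
  let u : Aˣ := ⟨1 - a, ∑' k : ℕ, a ^ k, ha.one_sub_mul_tsum_pow, ha.tsum_pow_mul_one_sub⟩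
  exact ⟨⟨u, rfl⟩, Ring.inverse_unit u⟩

/-! ### Trace-preserving primitive maps. -/

section Matrix

variable {n : Type*} [Fintype n]

lemma traceProj_apply (ρ M : Matrix n n ℂ) : traceProj ρ M = M.trace • ρ := rfl

lemma trace_pow_apply {L : Module.End ℂ (Matrix n n ℂ)} (hL : ∀ M, (L M).trace = M.trace) (k : ℕ)
    (M : Matrix n n ℂ) : ((L ^ k) M).trace = M.trace := by
  induction k with
  | zero => simp
  | succ k ih => rw [pow_succ', Module.End.mul_apply, hL, ih]

lemma nonempty_of_trace_eq_one {M : Matrix n n ℂ} (hM : M.trace = 1) : Nonempty n := by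
  by_contra h
  rw [not_nonempty_iff] at h
  simp [Matrix.trace] at hM

lemma continuous_trace : Continuous fun M : Matrix n n ℂ => M.trace :=
  (Matrix.traceLinearMap n ℂ ℂ).continuous_of_finiteDimensional

lemma apply_eq_self_of_tendsto_pow {L : Module.End ℂ (Matrix n n ℂ)} {ρ : Matrix n n ℂ}
    (htr : ρ.trace = 1)
    (hlim : ∀ M : Matrix n n ℂ, Tendsto (fun k : ℕ => (L ^ k) M) atTop (𝓝 (M.trace • ρ))) :
    L ρ = ρ := by
  have h1 : Tendsto (fun k : ℕ => (L ^ k) ρ) atTop (𝓝 ρ) := by simpa [htr] using hlim ρ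
  have h2 := (L.continuous_of_finiteDimensional.tendsto _).comp h1
  refine tendsto_nhds_unique h2 ((h1.comp (tendsto_add_atTop_nat 1)).congr fun k => ?_)
  simp [pow_succ']

/-- One application of $L-\tilde L$, where $\tilde L$ is `traceProj ρ`, lands in the traceless
matrices; there its powers agree with those of $L$, whose limit is $0$. -/
lemma tendsto_sub_traceProj_pow {L : Module.End ℂ (Matrix n n ℂ)}
    (hL : ∀ M, (L M).trace = M.trace) {ρ : Matrix n n ℂ} (htr : ρ.trace = 1)
    (hlim : ∀ M : Matrix n n ℂ, Tendsto (fun k : ℕ => (L ^ k) M) atTop (𝓝 (M.trace • ρ)))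
    (M : Matrix n n ℂ) : Tendsto (fun k : ℕ => ((L - traceProj ρ) ^ k) M) atTop (𝓝 0) := by
  have hpow : ∀ (N : Matrix n n ℂ), N.trace = 0 → ∀ k : ℕ,
      ((L - traceProj ρ) ^ k) N = (L ^ k) N := by
    intro N hN k
    induction k with
    | zero => simp
    | succ k ih =>
      rw [pow_succ', Module.End.mul_apply, ih, LinearMap.sub_apply, traceProj_apply,
        trace_pow_apply hL, hN, zero_smul, sub_zero, pow_succ', Module.End.mul_apply]
  refine (tendsto_add_atTop_iff_nat 1).1 ?_
  have hN : ((L - traceProj ρ) M).trace = 0 := by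
    simp [traceProj_apply, Matrix.trace_sub, Matrix.trace_smul, hL, htr]
  have h := hlim ((L - traceProj ρ) M)
  rw [hN, zero_smul] at h
  refine h.congr fun k => ?_
  rw [pow_succ, Module.End.mul_apply, hpow _ hN]

variable [DecidableEq n]

/-- A primitive trace-preserving map has spectral radius one and its powers converge to the
projection onto a state. -/
lemma IsPrimitive.exists_tendsto {L : Module.End ℂ (Matrix n n ℂ)} (hprim : IsPrimitive L)
    (hL : ∀ M, (L M).trace = M.trace) :
    specRad L = 1 ∧ ∃ ρ : Matrix n n ℂ, ρ.PosDef ∧ ρ.trace = 1 ∧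
      ∀ M, Tendsto (fun k : ℕ => (L ^ k) M) atTop (𝓝 (M.trace • ρ)) := by
  obtain ⟨hr, ρ₀, A₀, hρ₀, -, htr, hlim⟩ := hprim
  have : Nonempty n := nonempty_of_trace_eq_one htr
  have hpos : 0 < ρ₀.trace := hρ₀.trace_pos
  set c : ℂ := (((specRad L)⁻¹ : ℝ) : ℂ) with hc
  have htrlim : ∀ H : Matrix n n ℂ, H.IsHermitian →
      Tendsto (fun k : ℕ => c ^ k * H.trace) atTop (𝓝 ((A₀ * H).trace * ρ₀.trace)) := by
    intro H hH
    have h := (continuous_trace.tendsto _).comp (hlim H hH)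
    simpa [Function.comp_def, smul_pow, Matrix.trace_smul, trace_pow_apply hL] using h
  -- The trace of the limit at $H=\rho_0$ gives $c^k\to1$; shifting the index by one gives $c=1$.
  have hc1 : c = 1 := by
    have h1 := (htrlim ρ₀ hρ₀.isHermitian).mul_const (ρ₀.trace)⁻¹
    simp only [mul_assoc, mul_inv_cancel₀ hpos.ne', Matrix.trace_mul_comm A₀ ρ₀, htr, mul_one] at h1
    have h2 := h1.const_mul c
    simp only [← pow_succ', mul_one] at h2
    exact tendsto_nhds_unique h2 (h1.comp (tendsto_add_atTop_nat 1))
  have hrad : specRad L = 1 := by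
    have : (specRad L)⁻¹ = 1 := Complex.ofReal_injective (by rw [← hc, hc1, Complex.ofReal_one])
    exact inv_eq_one.1 this
  refine ⟨hrad, (ρ₀.trace)⁻¹ • ρ₀, hρ₀.smul (inv_pos.2 hpos), ?_, ?_⟩
  · rw [Matrix.trace_smul, smul_eq_mul, inv_mul_cancel₀ hpos.ne']
  have hherm : ∀ H : Matrix n n ℂ, H.IsHermitian →
      Tendsto (fun k : ℕ => (L ^ k) H) atTop (𝓝 (H.trace • (ρ₀.trace)⁻¹ • ρ₀)) := by
    intro H hH
    have h1 := htrlim H hH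
    have h2 := hlim H hH
    simp only [hc1, one_pow, one_mul, one_smul] at h1 h2
    -- With $c=1$ the trace sequence is constant, so
    -- $\operatorname{Tr}H=\operatorname{Tr}(A_0H)\operatorname{Tr}\rho_0$: the functional given by
    -- $A_0$ is a multiple of the trace.
    rwa [tendsto_nhds_unique tendsto_const_nhds h1, smul_smul, mul_assoc,
      mul_inv_cancel₀ hpos.ne', mul_one]
  intro M
  have h := (hherm _ (realPart M).2).add ((hherm _ (imaginaryPart M).2).const_smul Complex.I)
  have hM := realPart_add_I_smul_imaginaryPart M
  conv => enter [1, k]; rw [← hM]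
  conv in M.trace => rw [← hM]
  simpa [Matrix.trace_add, Matrix.trace_smul, add_mul, add_smul, smul_smul, mul_assoc] using h

end Matrix

/-! ### Moments of the outcome distribution. -/

section Variance

variable {n Ω : Type*} [Fintype n] [DecidableEq n] [Fintype Ω]

lemma total_apply (C : Ω → (Matrix n n ℂ →CP Matrix n n ℂ)) (M : Matrix n n ℂ) :
    total C M = ∑ ω, C ω M := by
  simp only [total, LinearMap.sum_apply]
  rfl

lemma re_trace_apply_nonneg_and_ofReal_eq {C : Matrix n n ℂ →CP Matrix n n ℂ} {ρ : Matrix n n ℂ}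
    (hρ : ρ.PosSemidef) : 0 ≤ (C ρ).trace.re ∧ (((C ρ).trace.re : ℝ) : ℂ) = (C ρ).trace := by
  have h : 0 ≤ (C ρ).trace :=
    (Matrix.nonneg_iff_posSemidef.1 (map_nonneg C (Matrix.nonneg_iff_posSemidef.2 hρ))).trace_nonneg
  rw [Complex.nonneg_iff] at h
  exact ⟨h.1, Complex.ext rfl (by simpa using h.2)⟩

variable [MeasurableSpace Ω]

lemma isProbabilityMeasure_outcomeLaw {C : Ω → (Matrix n n ℂ →CP Matrix n n ℂ)}
    (hC : ∀ M : Matrix n n ℂ, (total C M).trace = M.trace) {ρ : Matrix n n ℂ}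
    (hρ : ρ.PosSemidef) (htr : ρ.trace = 1) : IsProbabilityMeasure (outcomeLaw C ρ) := by
  constructor
  have hsum : ∑ ω, (C ω ρ).trace.re = 1 := by
    have h := hC ρ
    rw [total_apply, Matrix.trace_sum, htr] at h
    simpa using congrArg Complex.re h
  simp only [outcomeLaw, Measure.coe_finsetSum, Finset.sum_apply, Measure.smul_apply,
    measure_univ, smul_eq_mul, mul_one]
  rw [← ENNReal.ofReal_sum_of_nonneg fun ω _ => (re_trace_apply_nonneg_and_ofReal_eq hρ).1, hsum,
    ENNReal.ofReal_one]

variable [MeasurableSingletonClass Ω]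

lemma integral_outcomeLaw (C : Ω → (Matrix n n ℂ →CP Matrix n n ℂ)) {ρ : Matrix n n ℂ}
    (hρ : ρ.PosSemidef) (f : Ω → ℝ) :
    ∫ ω, f ω ∂(outcomeLaw C ρ) = ∑ ω, (C ω ρ).trace.re * f ω := by
  rw [outcomeLaw, integral_finsetSum_measure]
  · refine Finset.sum_congr rfl fun ω _ => ?_
    rw [integral_smul_measure, integral_dirac,
      ENNReal.toReal_ofReal (re_trace_apply_nonneg_and_ofReal_eq hρ).1, smul_eq_mul]
  · exact fun ω _ => (integrable_dirac (by simp)).smul_measure ENNReal.ofReal_ne_top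

lemma variance_outcomeLaw {C : Ω → (Matrix n n ℂ →CP Matrix n n ℂ)}
    (hC : ∀ M : Matrix n n ℂ, (total C M).trace = M.trace) {ρ : Matrix n n ℂ}
    (hρ : ρ.PosSemidef) (htr : ρ.trace = 1) (x : Ω → ℝ) :
    ((Var[x; outcomeLaw C ρ] : ℝ) : ℂ) =
      ∑ ω, (x ω : ℂ) ^ 2 * (C ω ρ).trace - (∑ ω, (x ω : ℂ) * (C ω ρ).trace) ^ 2 := by
  have := isProbabilityMeasure_outcomeLaw hC hρ htr
  have hmem : MemLp x 2 (outcomeLaw C ρ) := MemLp.of_discrete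
  rw [ProbabilityTheory.variance_eq_sub hmem, integral_outcomeLaw C hρ, integral_outcomeLaw C hρ]
  push_cast
  simp only [(re_trace_apply_nonneg_and_ofReal_eq hρ).2, Pi.pow_apply, Complex.ofReal_pow, mul_comm]

end Variance

end QuantumHMM

theorem theorem5 {n Ω : Type*} [Fintype n] [DecidableEq n]
    [Fintype Ω] [MeasurableSpace Ω] [MeasurableSingletonClass Ω]
    (C : Ω → (Matrix n n ℂ →CP Matrix n n ℂ))
    (hC : ∀ M : Matrix n n ℂ, (QuantumHMM.total C M).trace = M.trace)
    (x : Ω → ℝ)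
    (hprim : QuantumHMM.IsPrimitive (QuantumHMM.total C)) :
    (∃! ρ₀ : Matrix n n ℂ, QuantumHMM.IsPerronFrobeniusState (QuantumHMM.total C) ρ₀) ∧
    ∀ ρ₀ : Matrix n n ℂ, QuantumHMM.IsPerronFrobeniusState (QuantumHMM.total C) ρ₀ →
      IsUnit (1 - (QuantumHMM.total C - QuantumHMM.traceProj ρ₀)) ∧
      (∀ M : Matrix n n ℂ,
        HasSum (fun k : ℕ => ((QuantumHMM.total C - QuantumHMM.traceProj ρ₀) ^ k) M)
          (QuantumHMM.fundamental (QuantumHMM.total C) ρ₀ M)) ∧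
      ContDiffAt ℝ 2 (QuantumHMM.phi C x) 0 ∧
      ((iteratedDeriv 2 (QuantumHMM.phi C x) 0 : ℝ) : ℂ) =
        ((Var[x; QuantumHMM.outcomeLaw C ρ₀] : ℝ) : ℂ) +
          2 * ((QuantumHMM.weighted C x ∘ₗ
            (QuantumHMM.fundamental (QuantumHMM.total C) ρ₀ - QuantumHMM.traceProj ρ₀) ∘ₗ
            QuantumHMM.weighted C x) ρ₀).trace := by
  open QuantumHMM in
  obtain ⟨hrad, ρ, hρpos, hρtr, hlim⟩ := hprim.exists_tendsto hC
  have hfix := apply_eq_self_of_tendsto_pow hρtr hlim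
  have huniq : ∀ σ, IsPerronFrobeniusState (total C) σ → σ = ρ := by
    intro σ hσ
    have hσfix : total C σ = σ := by simpa [hrad] using hσ.eigen
    have hpow : ∀ k : ℕ, ((total C) ^ k) σ = σ := by
      intro k
      induction k with
      | zero => simp
      | succ k ih => rw [pow_succ', Module.End.mul_apply, ih, hσfix]
    have h := hlim σ
    simp only [hpow, hσ.trace_eq_one, one_smul] at h
    exact tendsto_nhds_unique tendsto_const_nhds h
  refine ⟨⟨ρ, ⟨hρpos, hρtr, by simp [hrad, hfix]⟩, huniq⟩, ?_⟩
  intro σ hσ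
  obtain rfl := huniq σ hσ
  clear hσ huniq
  have : Nonempty n := nonempty_of_trace_eq_one hρtr
  have hDlim := tendsto_sub_traceProj_pow hC hρtr hlim
  have hsum := summable_pow_of_tendsto_pow_apply hDlim
  obtain ⟨hunit, hinv⟩ := isUnit_one_sub_of_summable hsum
  -- The algebra isomorphism onto continuous linear maps supplies a norm; units, inverses and
  -- spectra carry over along it.
  set Φ := Module.End.toContinuousLinearMap (𝕜 := ℂ) (Matrix n n ℂ) with hΦ
  have hΦ1 : 1 - Φ (total C - traceProj σ) = Φ (1 - (total C - traceProj σ)) := by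
    rw [map_sub Φ 1, map_one]
  have hunit' : IsUnit (1 - (total C - traceProj σ)) := by
    rw [hΦ1] at hunit
    exact (MulEquiv.isUnit_map Φ).1 hunit
  have hfund : Φ (fundamental (total C) σ) * (1 - Φ (total C - traceProj σ)) = 1 := by
    rw [hΦ1, ← map_mul, fundamental, Ring.inverse_mul_cancel _ hunit', map_one]
  have hfundsum : Φ (fundamental (total C) σ) = ∑' k : ℕ, Φ (total C - traceProj σ) ^ k := by
    rw [← hinv, ← mul_one (Ring.inverse _)]
    exact ((Ring.eq_mul_inverse_iff_mul_eq _ _ _ hunit).2 hfund).trans (by simp)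
  refine ⟨hunit', ?_, ?_⟩
  · intro M
    have h := (ContinuousLinearMap.apply ℂ (Matrix n n ℂ) M).hasSum hsum.hasSum
    rw [← hfundsum] at h
    convert! h using 2 with k
    simp only [← map_pow]
    rfl
  · set K : Ω → Matrix n n ℂ →L[ℂ] Matrix n n ℂ := fun ω => Φ (C ω).toLinearMap with hK
    set τ : Matrix n n ℂ →L[ℂ] ℂ := LinearMap.toContinuousLinearMap (Matrix.traceLinearMap n ℂ ℂ)
      with hτ
    have hKsum : ∑ ω, K ω = Φ (total C) := by simp [hK, total]
    have hproj : τ.smulRight σ = Φ (traceProj σ) := rfl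
    have hsub : ∑ ω, K ω - τ.smulRight σ = Φ (total C - traceProj σ) := by
      rw [hKsum, hproj, map_sub]
    have hmain := iteratedDeriv_two_log_spectralRadius_expFamily K x (ρ := σ) (τ := τ)
      (Z := Φ (fundamental (total C) σ)) (f := phi C x) (fun ω M => map_star (C ω) M) hρtr
      (by rw [hKsum]; exact hfix) (by rw [hKsum]; exact hC) (by
        intro μ hμ hμ1
        rw [hKsum] at hμ
        obtain ⟨w, hw, hLw⟩ := (mem_spectrum_iff_exists_eigenvector _ _).1 hμ
        replace hLw : total C w = μ • w := hLw
        -- Trace preservation gives $(\mu-1)\operatorname{Tr}w=0$, so an eigenvector with $\mu\ne1$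
        -- is traceless and its orbit tends to $0$.
        have hw0 : w.trace = 0 := by
          have h := hC w
          rw [hLw, Matrix.trace_smul, smul_eq_mul] at h
          have h' : (μ - 1) * w.trace = 0 := by rw [sub_mul, h, one_mul, sub_self]
          exact (mul_eq_zero.1 h').resolve_left (sub_ne_zero.2 hμ1)
        exact norm_lt_one_of_tendsto_pow hw hLw (by simpa [hw0] using hlim w))
      (by rwa [hsub]) (by rwa [hsub]) (by
        intro t
        have : expFamily K x t = Φ (tilted C x t) := by simp [expFamily, hK, tilted]
        rw [this, phi, specRad, spectralRadius, spectralRadius, AlgEquiv.spectrum_eq])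
    refine ⟨hmain.1, hmain.2.trans ?_⟩
    have hwsum : ∑ ω, (x ω : ℂ) • K ω = Φ (weighted C x) := by
      simp only [hK, weighted, map_sum, map_smul]
    have hτK : ∀ a : Ω → ℂ, τ ((∑ ω, a ω • K ω) σ) = ∑ ω, a ω * (C ω σ).trace := by
      intro a
      simp only [sum_apply, smul_apply, map_sum, map_smul, smul_eq_mul]
      rfl
    rw [variance_outcomeLaw hC hρpos.posSemidef hρtr, hτK, hτK, hwsum, hproj]
    rfl
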